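/- \textbf{Setting.} Let $h_\theta$ ($\theta\in\mathbb R^d$) be hypotheses on a normed input space $X$, $\ell$ a real loss, $\mathcal Z\subseteq X\times Y$ the set of examples, $\rho\ge 0$, and $\|\cdot\|$ a norm on $\mathbb R^d$. For $z=(x,y)$ write $\ell(\theta,z)=\ell(h_\theta(x),y)$ and $\ell^A(\theta,z)=\max_{\|x'-x\|\le\rho}\ell(h_\theta(x'),y)$ (a supremum if it is not attained). For $S=(z_1,\dots,z_N)\in\mathcal Z^N$ let $\hat{\mathcal R}^A_S(\theta)=\frac1N\sum_{i=1}^N \ell^A(\theta,z_i)$. For $b>0$ let $\mathrm{Lap}(m,b)$ be the probability measure on $\mathbb R^d$ with density proportional to $g\mapsto e^{-\|m-g\|/b}$. $T$-iteration adversarial training on $S$ with learning rates $\eta_t$ and initial weight $\theta^A_1$ is $\theta^A_{t+1}=\theta^A_t-\eta_t\hat g^A_t$ ($1\le t\le T$), where, given the past, the stochastic gradient satisfies $\hat g^A_t\sim \mathrm{Lap}(\nabla\hat{\mathcal R}^A_S(\theta^A_t),b)$; its output is $\mathcal A(S)=\theta^A_{T+1}$. SGD for ERM on $S$ with mini batches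 $\mathcal B_t$ is $\theta^{\mathrm{ERM}}_{t+1}=\theta^{\mathrm{ERM}}_t-\eta_t\frac1{|\mathcal B_t|}\sum_{z\in\mathcal B_t}\nabla_\theta\ell(\theta^{\mathrm{ERM}}_t,z)$. Put $$L^A_t=\max_{z\in\mathcal Z}\|\nabla_\theta\ell^A(\theta^A_t,z)\|,\quad L^{\mathrm{ERM}}_t=\max_{z\in\mathcal Z}\|\nabla_\theta\ell(\theta^{\mathrm{ERM}}_t,z)\|,\quad I_t=\frac{L^A_t}{L^{\mathrm{ERM}}_t},$$ $$L^{\mathrm{ERM}}_{1:T}=\Big(\frac1T\sum_{t=1}^T (L^{\mathrm{ERM}}_t)^4\Big)^{1/4},\qquad I_{1:T}=\Big(\frac1T\sum_{t=1}^T I_t^4\Big)^{1/4}$$ (maxima over $\mathcal Z$ are read as suprema). $\mathcal A$ is $(\varepsilon,\delta)$-differentially private if $\mathbb P(\mathcal A(S)\in B)\le e^{\varepsilon}\,\mathbb P(\mathcal A(S')\in B)+\delta$ for all measurable $B$ and all $S,S'\in\mathcal Z^N$ that differ in at most one example. \textbf{Assumptions.} For all $N\ge1$ and $S\in\mathcal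 Z^N$: for each $z\in\mathcal Z$, almost surely $\ell^A(\cdot,z)$ is differentiable at $\theta^A_1,\dots,\theta^A_T$; and almost surely $\|\nabla_\theta\ell^A(\theta^A_t,z)\|\le M$ for all $t\le T$, $z\in\mathcal Z$, with a constant $M$ that does not depend on $N$ and $S$. \textbf{Theorem (Privacy-robustness relationship II).} There is a constant $C$, independent of $N$, $\delta'$ and the mini batches, such that the following holds for all $N\ge1$ and $\delta'>0$ and every choice of mini batches for ERM on each $S\in\mathcal Z^N$ for which all $L^{\mathrm{ERM}}_t$ are positive and finite. The quantity $\frac{2L^{\mathrm{ERM}}_{1:T}}{Nb}I_{1:T}$ depends on $S$ and on the training run; let $\varepsilon_{1:T}$ be any real number such that, for every $S\in\mathcal Z^N$, almost surely $$\frac{2L^{\mathrm{ERM}}_{1:T}}{Nb}\,I_{1:T}\le\varepsilon_{1:T}.$$ (The least such number may be taken; it is the quantity itself when that is deterministic.) Then adversarial training is $(\varepsilon_A,\delta_A)$-differentially private with $$\varepsilon_A=\varepsilon_{1:T}\sqrt{2T\log\frac N{\delta'}}+\frac C{N^2},\qquad \delta_A=\frac{\delta'}N,$$ where the square root is read as $0$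 if $\delta'>N$. In particular $\varepsilon_A=\varepsilon_{1:T}\sqrt{2T\log(N/\delta')}+\mathcal O(1/N^2)$. -/

import Mathlib

open MeasureTheory
open scoped NNReal

noncomputable section

/-- The parameter space `ℝ^d`; its inner product identifies differentials with gradients. -/
abbrev Param (d : ℕ) : Type := EuclideanSpace ℝ (Fin d)

/-- The data of an adversarial training problem: the hypotheses `h_θ`, the loss `ℓ`, the
perturbation radius `ρ`, the example space `𝒵 ⊆ X × Y`, and the norm on the parameter space
(an arbitrary norm on `ℝ^d`, so that the Euclidean and the `ℓ¹` norm are both covered). The norm of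
the type `X` is the one in which perturbations of inputs are measured. -/
structure AdvProblem (d : ℕ) (X Y W : Type*) [NormedAddCommGroup X] [NormedSpace ℝ X] where
  hyp : Param d → X → W
  loss : W → Y → ℝ
  radius : ℝ≥0
  examples : Set (X × Y)
  paramNorm : Seminorm ℝ (Param d)
  eq_zero_of_paramNorm : ∀ v, paramNorm v = 0 → v = 0

/-- The unnormalized density `g ↦ exp (-‖m - g‖ / b)` of the Laplace distribution. -/
def laplaceWeight {d : ℕ} (p : Seminorm ℝ (Param d)) (m : Param d) (b : ℝ) (g : Param d) :
    ENNReal :=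
  ENNReal.ofReal (Real.exp (-(p (m - g)) / b))

/-- The Laplace distribution `Lap(m, b)` on `ℝ^d` with respect to the norm `p`: the probability
measure with Lebesgue density proportional to `exp (-‖m - g‖ / b)`. -/
def laplace {d : ℕ} (p : Seminorm ℝ (Param d)) (m : Param d) (b : ℝ) : Measure (Param d) :=
  (∫⁻ g, laplaceWeight p m b g)⁻¹ • (volume : Measure (Param d)).withDensity (laplaceWeight p m b)

/-- `m + ξ` has law `Lap(m, b)` when `ξ` has law `Lap(0, b)`. -/
theorem map_add_laplace_zero {d : ℕ} (p : Seminorm ℝ (Param d)) (m : Param d) (b : ℝ) :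
    (laplace p 0 b).map (fun ξ => m + ξ) = laplace p m b := by
  have hw : ∀ ξ, laplaceWeight p m b (m + ξ) = laplaceWeight p 0 b ξ := by
    intro ξ
    simp [laplaceWeight]
  have hZ : ∫⁻ g, laplaceWeight p m b g = ∫⁻ g, laplaceWeight p 0 b g := by
    rw [← lintegral_add_left_eq_self (laplaceWeight p m b) m]
    simp only [hw]
  have hm : Measurable (fun ξ : Param d => m + ξ) := measurable_const_add m
  unfold laplace
  rw [Measure.map_smul, hZ]
  congr 1
  ext s hs
  rw [Measure.map_apply hm hs, withDensity_apply _ (hm hs), withDensity_apply _ hs,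
    ← lintegral_indicator (hm hs), ← lintegral_indicator hs,
    ← lintegral_add_left_eq_self (s.indicator (laplaceWeight p m b)) m]
  refine lintegral_congr fun ξ => ?_
  by_cases h : m + ξ ∈ s <;> simp [Set.indicator, h, hw]

/-- Weights of stochastic gradient descent with (stochastic) gradient `g t θ` in step `t`. Time is
counted from `0`: `sgd θ₁ η g t` is the weight at which the `(t+1)`-st iteration starts. -/
def sgd {d : ℕ} (θ₁ : Param d) (η : ℕ → ℝ) (g : ℕ → Param d → Param d) : ℕ → Param d
  | 0 => θ₁
  | t + 1 => sgd θ₁ η g t - η t • g t (sgd θ₁ η g t)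

/-- `(1/T ∑_{t ≤ T} a_t⁴)^{1/4}`. -/
def fourthMean (T : ℕ) (a : ℕ → ℝ) : ℝ :=
  ((1 / (T : ℝ)) * ∑ t ∈ Finset.range T, a t ^ 4) ^ (1 / 4 : ℝ)

namespace AdvProblem

variable {d : ℕ} {X Y W : Type*} [NormedAddCommGroup X] [NormedSpace ℝ X]

/-- `ℓ(h_θ(x), y)`. -/
def stdLoss (P : AdvProblem d X Y W) (z : X × Y) (θ : Param d) : ℝ :=
  P.loss (P.hyp θ z.1) z.2

/-- `max_{‖x' - x‖ ≤ ρ} ℓ(h_θ(x'), y)`. -/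
def robustLoss (P : AdvProblem d X Y W) (z : X × Y) (θ : Param d) : ℝ :=
  sSup ((fun x' => P.loss (P.hyp θ x') z.2) '' Metric.closedBall z.1 P.radius)

/-- The adversarial empirical risk of a sample set `S` of size `N`. -/
def advRisk (P : AdvProblem d X Y W) {N : ℕ} (S : Fin N → P.examples) (θ : Param d) : ℝ :=
  (1 / (N : ℝ)) * ∑ i, P.robustLoss (S i) θ

/-- `max_{z ∈ 𝒵} ‖∇_θ max_{‖x' - x‖ ≤ ρ} ℓ(h_θ(x'), y)‖` at the weight `θ`. -/
def gradMaxAdv (P : AdvProblem d X Y W) (θ : Param d) : ℝ :=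
  sSup ((fun z => P.paramNorm (gradient (P.robustLoss z) θ)) '' P.examples)

/-- `max_{z ∈ 𝒵} ‖∇_θ ℓ(h_θ(x), y)‖` at the weight `θ`. -/
def gradMaxERM (P : AdvProblem d X Y W) (θ : Param d) : ℝ :=
  sSup ((fun z => P.paramNorm (gradient (P.stdLoss z) θ)) '' P.examples)

/-- The law of the gradient noise of `T` iterations: independent `Lap(0, b)` vectors. -/
def noiseLaw (P : AdvProblem d X Y W) (b : ℝ) (T : ℕ) : Measure (Fin T → Param d) :=
  Measure.pi fun _ => laplace P.paramNorm 0 b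

/-- The weights of `T`-iteration adversarial training on `S`, where the stochastic gradient at `θ`
in step `t` is `∇ R^A_S(θ) + ξ_t`, so that it is drawn from `Lap(∇ R^A_S(θ), b)` when the `ξ_t` are
drawn from `Lap(0, b)`. -/
def advIterate (P : AdvProblem d X Y W) (η : ℕ → ℝ) (θ₁ : Param d) {N T : ℕ}
    (S : Fin N → P.examples) (ξ : Fin T → Param d) : ℕ → Param d :=
  sgd θ₁ η fun t θ => gradient (P.advRisk S) θ + if h : t < T then ξ ⟨t, h⟩ else 0

/-- The weights of SGD for ERM on `S` with the mini batch `B t` in step `t`. -/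
def ermIterate (P : AdvProblem d X Y W) (η : ℕ → ℝ) (θ₁ : Param d) {N : ℕ}
    (S : Fin N → P.examples) (B : ℕ → Finset (Fin N)) : ℕ → Param d :=
  sgd θ₁ η fun t θ => (1 / ((B t).card : ℝ)) • ∑ i ∈ B t, gradient (P.stdLoss (S i)) θ

/-- The law of the output `𝒜(S)` of `T`-iteration adversarial training. -/
def advTraining (P : AdvProblem d X Y W) (b : ℝ) (T : ℕ) (η : ℕ → ℝ) (θ₁ : Param d) {N : ℕ}
    (S : Fin N → P.examples) : Measure (Param d) :=
  (P.noiseLaw b T).map fun ξ => P.advIterate η θ₁ S ξ T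

/-- `L^ERM_{1:T}` for the weight sequence `θE` of ERM. -/
def totalERM (P : AdvProblem d X Y W) (T : ℕ) (θE : ℕ → Param d) : ℝ :=
  fourthMean T fun t => P.gradMaxERM (θE t)

/-- The single-iteration robustified intensity, for the weights of adversarial training and of ERM
at the iteration in question. -/
def intensity (P : AdvProblem d X Y W) (θA θE : Param d) : ℝ :=
  P.gradMaxAdv θA / P.gradMaxERM θE

/-- The robustified intensity `I_{1:T}`, for weight sequences of adversarial training and ERM. -/
def totalIntensity (P : AdvProblem d X Y W) (T : ℕ) (θA θE : ℕ → Param d) : ℝ :=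
  fourthMean T fun t => P.intensity (θA t) (θE t)

/-- `ε_{1:T} = 2 L^ERM_{1:T} / (N b) * I_{1:T}`. -/
def privacyScale (P : AdvProblem d X Y W) (b : ℝ) (N T : ℕ) (θA θE : ℕ → Param d) : ℝ :=
  2 * P.totalERM T θE / (N * b) * P.totalIntensity T θA θE

end AdvProblem

/-- `(ε, δ)`-differential privacy of the stochastic algorithm whose output on `S` has law `A S`.
This is `log ((P(A(S) ∈ B) - δ) / P(A(S') ∈ B)) ≤ ε` for all neighbouring `S`, `S'` and all events
`B`, written without the logarithm, so that it makes sense also when the quotient does not. -/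
def IsDifferentiallyPrivate {Z H : Type*} [MeasurableSpace H] {N : ℕ}
    (A : (Fin N → Z) → Measure H) (ε δ : ℝ) : Prop :=
  ∀ S S' : Fin N → Z, (∃ i, ∀ j, j ≠ i → S j = S' j) → ∀ B : Set H, MeasurableSet B →
    (A S).real B ≤ Real.exp ε * (A S').real B + δ

end

/-!
Two runs of adversarial training on neighbouring samples `S`, `S'` are compared on the noise space.
Let `m`, `m'` be the gradients of the two adversarial risks. If the noise `ξ t` is replaced by
`ξ t + m (θ t) - m' (θ t)`, with `θ t` the weights visited on `S`, then training on `S'` visits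
exactly the weights of `S` (`noisySGD_shiftNoise`). The density of the noise changes by the factor
`exp (-L)`, where the privacy loss `L` is the sum of the log-likelihood ratios of the steps
(`lintegral_exp_neg_privacyLoss_mul`). So the law of the output on `S` is bounded by `exp ε` times
that on `S'`, up to the probability that `L > ε` (`measure_noisySGD_le`).

That probability is bounded as in the advanced composition theorem. Given the past, the loss of a
step with sensitivity `Δ = ‖m (θ t) - m' (θ t)‖ / b` lies in `[-Δ, Δ]`, and its mean is at most
`Δ² exp Δ`, because `exp (-z)` has mean one for a log-likelihood ratio `z`. Hoeffding's lemma
turns `exp (c L)` into a supermartingale after compensation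
(`lintegral_exp_mul_privacyLoss_sub_le_one`), and Chernoff's bound with the optimal `c` gives
`L ≤ √(2 V log (1/δ)) + K` outside an event of probability `δ`, where `V` bounds `∑ Δ²` and `K`
bounds `∑ Δ² exp Δ` (`measure_privacyLoss_gt_le`).

Finally, `m` and `m'` differ in one of `N` summands, so `Δ ≤ 2 L^A_t / (N b)`. The uniform gradient
bound makes `K` of order `1/N²`, and the Cauchy–Schwarz inequality, applied to
`L^A_t = L^ERM_t · I_t`, shows that `V = T ε_{1:T}²` is admissible
(`AdvProblem.sum_sq_sensitivity_le`).
-/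

open MeasureTheory
open scoped NNReal

noncomputable section

/-! ### The Laplace distribution of a norm -/

theorem Seminorm.continuous_of_finiteDimensional {E : Type*} [NormedAddCommGroup E]
    [NormedSpace ℝ E] [FiniteDimensional ℝ E] (p : Seminorm ℝ E) : Continuous p :=
  p.convexOn.locallyLipschitz.continuous

theorem Seminorm.exists_pos_mul_norm_le {E : Type*} [NormedAddCommGroup E] [NormedSpace ℝ E]
    [FiniteDimensional ℝ E] (p : Seminorm ℝ E) (hp : ∀ v, p v = 0 → v = 0) :
    ∃ c : ℝ, 0 < c ∧ ∀ v, c * ‖v‖ ≤ p v := by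
  rcases subsingleton_or_nontrivial E with h | h
  · exact ⟨1, one_pos, fun v => by simp [Subsingleton.elim v 0]⟩
  obtain ⟨u, hu, hmin⟩ := (isCompact_sphere (0 : E) 1).exists_isMinOn
    (NormedSpace.sphere_nonempty.2 zero_le_one) p.continuous_of_finiteDimensional.continuousOn
  have hu0 : u ≠ 0 := by
    rintro rfl
    simp at hu
  refine ⟨p u, (apply_nonneg p u).lt_of_ne' fun h0 => hu0 (hp u h0), fun v => ?_⟩
  rcases eq_or_ne v 0 with rfl | hv
  · simp
  have hv' : 0 < ‖v‖ := norm_pos_iff.2 hv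
  have hmem : ‖v‖⁻¹ • v ∈ Metric.sphere (0 : E) 1 := by
    simp [norm_smul, hv'.ne']
  have h1 : p u ≤ p (‖v‖⁻¹ • v) := hmin hmem
  rw [map_smul_eq_mul, norm_inv, norm_norm, inv_mul_eq_div, le_div_iff₀ hv'] at h1
  exact h1

theorem integrable_exp_neg_mul_norm {E : Type*} [NormedAddCommGroup E] [NormedSpace ℝ E]
    [FiniteDimensional ℝ E] [MeasurableSpace E] [BorelSpace E] (μ : Measure E)
    [μ.IsAddHaarMeasure] {c : ℝ} (hc : 0 < c) : Integrable (fun x => Real.exp (-(c * ‖x‖))) μ := by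
  set n := Module.finrank ℝ E + 1 with hn
  have h : Integrable (fun x : E => (1 + ‖x‖) ^ (-(n : ℝ))) μ :=
    integrable_one_add_norm (by rw [hn]; push_cast; linarith)
  refine (h.const_mul (Real.exp c * n.factorial / c ^ n)).mono'
    (Continuous.aestronglyMeasurable (by fun_prop)) (.of_forall fun x => ?_)
  have hx : 0 < 1 + ‖x‖ := by positivity
  rw [Real.norm_of_nonneg (Real.exp_pos _).le, Real.rpow_neg hx.le, Real.rpow_natCast]
  have h1 := Real.pow_div_factorial_le_exp _ (mul_pos hc hx).le n
  have h2 : Real.exp (-(c * ‖x‖)) = Real.exp c / Real.exp (c * (1 + ‖x‖)) := by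
    rw [← Real.exp_sub]
    ring_nf
  have h3 : (0 : ℝ) < n.factorial := by positivity
  calc Real.exp (-(c * ‖x‖)) ≤ Real.exp c / ((c * (1 + ‖x‖)) ^ n / n.factorial) := by
        rw [h2]
        gcongr
    _ = Real.exp c * n.factorial / c ^ n * ((1 + ‖x‖) ^ n)⁻¹ := by
        rw [mul_pow]
        field_simp

section Laplace

variable {d : ℕ} {p : Seminorm ℝ (Param d)} {b : ℝ}

theorem measurable_laplaceWeight (p : Seminorm ℝ (Param d)) (m : Param d) (b : ℝ) :
    Measurable (laplaceWeight p m b) := by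
  have := p.continuous_of_finiteDimensional
  unfold laplaceWeight
  fun_prop

theorem isProbabilityMeasure_laplace (hp : ∀ v, p v = 0 → v = 0) (hb : 0 < b) (m : Param d) :
    IsProbabilityMeasure (laplace p m b) := by
  have hZ : ∫⁻ g, laplaceWeight p m b g ≠ ⊤ := by
    obtain ⟨c, hc, hcp⟩ := p.exists_pos_mul_norm_le hp
    have hint := (integrable_exp_neg_mul_norm (volume : Measure (Param d))
      (div_pos hc hb)).comp_sub_left m
    refine ((lintegral_mono fun g => ENNReal.ofReal_le_ofReal (Real.exp_le_exp.2 ?_)).trans_lt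
      hint.lintegral_lt_top).ne
    rw [neg_div, neg_le_neg_iff, div_mul_eq_mul_div]
    gcongr
    exact hcp _
  have hZ0 : ∫⁻ g, laplaceWeight p m b g ≠ 0 := by
    rw [Ne, lintegral_eq_zero_iff (measurable_laplaceWeight p m b)]
    intro h
    obtain ⟨x, hx⟩ := h.exists
    simp only [laplaceWeight, Pi.zero_apply, ENNReal.ofReal_eq_zero] at hx
    exact absurd hx (Real.exp_pos _).not_ge
  refine ⟨?_⟩
  rw [laplace, Measure.smul_apply, withDensity_apply _ .univ, Measure.restrict_univ, smul_eq_mul]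
  exact ENNReal.inv_mul_cancel hZ0 hZ

/-- The privacy loss of one draw: the log-likelihood ratio at the noise value `x` of the centred
Laplace distribution and of its translate by `-s`. -/
def lossIncrement (p : Seminorm ℝ (Param d)) (b : ℝ) (s x : Param d) : ℝ :=
  (p (x + s) - p x) / b

theorem continuous_lossIncrement (p : Seminorm ℝ (Param d)) (b : ℝ) :
    Continuous fun q : Param d × Param d => lossIncrement p b q.1 q.2 := by
  have := p.continuous_of_finiteDimensional
  unfold lossIncrement
  fun_prop

theorem abs_lossIncrement_le (p : Seminorm ℝ (Param d)) (hb : 0 < b) (s x : Param d) :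
    |lossIncrement p b s x| ≤ p s / b := by
  rw [lossIncrement, abs_div, abs_of_pos hb]
  gcongr
  rw [abs_le]
  have h1 := map_add_le_add p x s
  have h2 := map_sub_le_add p (x + s) s
  rw [add_sub_cancel_right] at h2
  constructor <;> linarith

theorem lintegral_exp_neg_lossIncrement_mul (p : Seminorm ℝ (Param d)) (b : ℝ) (s : Param d)
    {F : Param d → ENNReal} (hF : Measurable F) :
    ∫⁻ x, ENNReal.ofReal (Real.exp (-lossIncrement p b s x)) * F (x + s) ∂(laplace p 0 b) =
      ∫⁻ x, F x ∂(laplace p 0 b) := by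
  have hw := measurable_laplaceWeight p 0 b
  have hc := continuous_lossIncrement p b
  have hc' : Continuous fun x => lossIncrement p b s x := hc.comp (Continuous.prodMk_right s)
  have hm : Measurable fun x => ENNReal.ofReal (Real.exp (-lossIncrement p b s x)) * F (x + s) := by
    have : Measurable fun x => F (x + s) := hF.comp (measurable_add_const s)
    fun_prop
  rw [laplace, lintegral_smul_measure, lintegral_smul_measure,
    lintegral_withDensity_eq_lintegral_mul _ hw hm, lintegral_withDensity_eq_lintegral_mul _ hw hF,
    ← lintegral_add_right_eq_self (laplaceWeight p 0 b * F) s]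
  congr 1
  refine lintegral_congr fun x => ?_
  simp only [Pi.mul_apply]
  rw [← mul_assoc]
  congr 1
  simp only [laplaceWeight]
  rw [← ENNReal.ofReal_mul (Real.exp_pos _).le, ← Real.exp_add]
  simp only [zero_sub, map_neg_eq_map, lossIncrement]
  ring_nf

end Laplace

/-! ### The exponential moment of the privacy loss of one step -/

/-- If `exp (-z)` has mean `1`, as for a log-likelihood ratio `z`, then `z` has a mean of second
order in its bound `Δ`: this is the pointwise inequality `z ≤ 1 - exp (-z) + Δ² exp Δ`. -/
theorem le_one_sub_exp_neg_add {z Δ : ℝ} (h : |z| ≤ Δ) :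
    z ≤ 1 - Real.exp (-z) + Δ ^ 2 * Real.exp Δ := by
  have hΔ : 0 ≤ Δ := (abs_nonneg z).trans h
  have h1 : Real.exp (-z) * (z + 1) ≤ 1 := by
    calc Real.exp (-z) * (z + 1) ≤ Real.exp (-z) * Real.exp z := by
          gcongr
          exact Real.add_one_le_exp z
      _ = 1 := by rw [← Real.exp_add]; simp
  have h2 : |1 - Real.exp (-z)| ≤ Δ * Real.exp Δ := by
    have h3 : Real.exp Δ - 1 ≤ Δ * Real.exp Δ := by
      have := mul_le_mul_of_nonneg_left (Real.add_one_le_exp (-Δ)) (Real.exp_pos Δ).le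
      rw [← Real.exp_add] at this
      simp at this
      linarith
    have h4 : 1 ≤ Real.exp Δ := Real.one_le_exp hΔ
    have h5 : Real.exp (-z) ≤ Real.exp Δ := Real.exp_le_exp.2 (by linarith [(abs_le.1 h).1])
    have h6 : -Δ + 1 ≤ Real.exp (-z) :=
      (Real.add_one_le_exp (-Δ)).trans (Real.exp_le_exp.2 (by linarith [(abs_le.1 h).2]))
    rw [abs_le]
    constructor
    · linarith
    · nlinarith
  have h7 : z * (1 - Real.exp (-z)) ≤ Δ * (Δ * Real.exp Δ) := by
    refine (le_abs_self _).trans ?_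
    rw [abs_mul]
    gcongr
  nlinarith

/-- Bound for the cumulant generating function at `c` of the privacy loss of a step whose
sensitivity is `Δ`: the first term accounts for the mean, the second one for the fluctuation. -/
def cumulantBound (c Δ : ℝ) : ℝ := c * (Δ ^ 2 * Real.exp Δ) + c ^ 2 * Δ ^ 2 / 2

/-- Hoeffding's lemma for a log-likelihood ratio with values in `[-Δ, Δ]`. -/
theorem lintegral_exp_mul_sub_cumulantBound_le_one {Ω : Type*} [MeasurableSpace Ω]
    {μ : Measure Ω} [IsProbabilityMeasure μ] {z : Ω → ℝ} (hz : Measurable z) {Δ : ℝ}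
    (hzΔ : ∀ ω, |z ω| ≤ Δ)
    (hone : ∫⁻ ω, ENNReal.ofReal (Real.exp (-z ω)) ∂μ = 1) {c : ℝ} (hc : 0 ≤ c) :
    ∫⁻ ω, ENNReal.ofReal (Real.exp (c * z ω - cumulantBound c Δ)) ∂μ ≤ 1 := by
  have hmem : ∀ᵐ ω ∂μ, z ω ∈ Set.Icc (-Δ) Δ := .of_forall fun ω => abs_le.1 (hzΔ ω)
  have hzint : Integrable z μ := .of_mem_Icc _ _ hz.aemeasurable hmem
  have hexp : Integrable (fun ω => Real.exp (-z ω)) μ :=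
    ⟨by fun_prop, by
      rw [hasFiniteIntegral_iff_ofReal (.of_forall fun _ => (Real.exp_pos _).le), hone]
      simp⟩
  have hone' : ∫ ω, Real.exp (-z ω) ∂μ = 1 := by
    rw [integral_eq_lintegral_of_nonneg_ae (.of_forall fun _ => (Real.exp_pos _).le)
      (by fun_prop), hone]
    simp
  have hmean : ∫ ω, z ω ∂μ ≤ Δ ^ 2 * Real.exp Δ := by
    calc ∫ ω, z ω ∂μ ≤ ∫ ω, (1 - Real.exp (-z ω) + Δ ^ 2 * Real.exp Δ) ∂μ :=
          integral_mono hzint (((integrable_const _).sub hexp).add (integrable_const _))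
            fun ω => le_one_sub_exp_neg_add (hzΔ ω)
      _ = Δ ^ 2 * Real.exp Δ := by
          rw [integral_add (f := fun ω => 1 - Real.exp (-z ω)) ((integrable_const _).sub hexp)
              (integrable_const _), integral_sub (integrable_const _) hexp, hone']
          simp
  have hsub := ProbabilityTheory.hasSubgaussianMGF_of_mem_Icc hz.aemeasurable hmem
  have hmgf := hsub.mgf_le c
  have hΔ : ((‖Δ - -Δ‖₊ / 2 : ℝ≥0) ^ 2 : ℝ≥0) * c ^ 2 / 2 = c ^ 2 * Δ ^ 2 / 2 := by
    push_cast
    rw [Real.norm_eq_abs, div_pow, sq_abs]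
    ring
  rw [hΔ, ProbabilityTheory.mgf] at hmgf
  have hint := hsub.integrable_exp_mul c
  have hle : ∀ ω, c * z ω - cumulantBound c Δ ≤
      c * (z ω - ∫ ω, z ω ∂μ) - c ^ 2 * Δ ^ 2 / 2 := fun ω => by
    have := mul_le_mul_of_nonneg_left hmean hc
    rw [cumulantBound]
    linarith
  calc ∫⁻ ω, ENNReal.ofReal (Real.exp (c * z ω - cumulantBound c Δ)) ∂μ
      ≤ ∫⁻ ω, ENNReal.ofReal (Real.exp (c * (z ω - ∫ ω, z ω ∂μ)) *
          Real.exp (-(c ^ 2 * Δ ^ 2 / 2))) ∂μ := by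
        refine lintegral_mono fun ω => ENNReal.ofReal_le_ofReal ?_
        rw [← Real.exp_add]
        exact Real.exp_le_exp.2 (by linarith [hle ω])
    _ = ENNReal.ofReal ((∫ ω, Real.exp (c * (z ω - ∫ ω, z ω ∂μ)) ∂μ) *
          Real.exp (-(c ^ 2 * Δ ^ 2 / 2))) := by
        rw [← ofReal_integral_eq_lintegral_ofReal (hint.mul_const _)
          (.of_forall fun _ => by positivity), integral_mul_const]
    _ ≤ 1 := by
        rw [ENNReal.ofReal_le_one]
        calc _ ≤ Real.exp (c ^ 2 * Δ ^ 2 / 2) * Real.exp (-(c ^ 2 * Δ ^ 2 / 2)) := by gcongr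
          _ = 1 := by rw [← Real.exp_add]; simp

/-! ### Noisy gradient descent and its privacy loss -/

section Adaptive

variable {d : ℕ}

/-- The weight after `t` steps of gradient descent with gradient `m` and additive gradient noise
`ξ i` in step `i`. -/
def noisySGD (θ₁ : Param d) (η : ℕ → ℝ) (m : Param d → Param d) {n : ℕ} (ξ : Fin n → Param d)
    (t : ℕ) : Param d :=
  sgd θ₁ η (fun t θ => m θ + if h : t < n then ξ ⟨t, h⟩ else 0) t

variable {θ₁ : Param d} {η : ℕ → ℝ} {m m' : Param d → Param d} {n : ℕ}

theorem noisySGD_succ (ξ : Fin n → Param d) {t : ℕ} (h : t < n) :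
    noisySGD θ₁ η m ξ (t + 1) =
      noisySGD θ₁ η m ξ t - η t • (m (noisySGD θ₁ η m ξ t) + ξ ⟨t, h⟩) := by
  simp [noisySGD, sgd, h]

/-- The weight after `t` steps does not depend on later noise. -/
theorem noisySGD_snoc (ξ : Fin n → Param d) (x : Param d) {t : ℕ} (ht : t ≤ n) :
    noisySGD θ₁ η m (Fin.snoc ξ x : Fin (n + 1) → Param d) t = noisySGD θ₁ η m ξ t := by
  induction t with
  | zero => rfl
  | succ t ih =>
    rw [noisySGD_succ _ (Nat.lt_succ_of_lt ht), noisySGD_succ _ ht, ih (Nat.le_of_succ_le ht)]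
    congr 3
    exact Fin.snoc_castSucc (α := fun _ => Param d) x ξ ⟨t, ht⟩

theorem measurable_noisySGD (hm : Measurable m) (t : ℕ) :
    Measurable fun ξ : Fin n → Param d => noisySGD θ₁ η m ξ t := by
  induction t with
  | zero => exact measurable_const
  | succ t ih =>
    have hn : Measurable fun ξ : Fin n → Param d => if h : t < n then ξ ⟨t, h⟩ else 0 := by
      split_ifs <;> fun_prop
    exact ih.sub (((hm.comp ih).add hn).const_smul (η t))

/-- The difference of the two gradients at the weight reached with `m` after `t` steps. -/
def gradShift (θ₁ : Param d) (η : ℕ → ℝ) (m m' : Param d → Param d) {n : ℕ} (ξ : Fin n → Param d)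
    (t : ℕ) : Param d :=
  m (noisySGD θ₁ η m ξ t) - m' (noisySGD θ₁ η m ξ t)

theorem gradShift_snoc (ξ : Fin n → Param d) (x : Param d) {t : ℕ} (ht : t ≤ n) :
    gradShift θ₁ η m m' (Fin.snoc ξ x : Fin (n + 1) → Param d) t = gradShift θ₁ η m m' ξ t := by
  rw [gradShift, gradShift, noisySGD_snoc ξ x ht]

theorem measurable_gradShift (hm : Measurable m) (hm' : Measurable m') (t : ℕ) :
    Measurable fun ξ : Fin n → Param d => gradShift θ₁ η m m' ξ t :=
  (hm.comp (measurable_noisySGD hm t)).sub (hm'.comp (measurable_noisySGD hm t))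

/-- The noise that makes descent with gradient `m'` follow the weights which descent with gradient
`m` visits under the noise `ξ`. -/
def shiftNoise (θ₁ : Param d) (η : ℕ → ℝ) (m m' : Param d → Param d) {n : ℕ}
    (ξ : Fin n → Param d) : Fin n → Param d :=
  fun i => ξ i + gradShift θ₁ η m m' ξ i

theorem noisySGD_shiftNoise (ξ : Fin n → Param d) {t : ℕ} (ht : t ≤ n) :
    noisySGD θ₁ η m' (shiftNoise θ₁ η m m' ξ) t = noisySGD θ₁ η m ξ t := by
  induction t with
  | zero => rfl
  | succ t ih =>
    rw [noisySGD_succ _ ht, noisySGD_succ _ ht, ih (Nat.le_of_succ_le ht)]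
    simp only [shiftNoise, gradShift]
    congr 2
    abel

theorem shiftNoise_snoc (ξ : Fin n → Param d) (x : Param d) :
    shiftNoise θ₁ η m m' (Fin.snoc ξ x : Fin (n + 1) → Param d) =
      Fin.snoc (shiftNoise θ₁ η m m' ξ) (x + gradShift θ₁ η m m' ξ n) := by
  funext i
  refine Fin.lastCases ?_ (fun i => ?_) i
  · simp [shiftNoise, gradShift_snoc]
  · simp [shiftNoise, gradShift_snoc, i.2.le]

theorem measurable_shiftNoise (hm : Measurable m) (hm' : Measurable m') :
    Measurable (shiftNoise θ₁ η m m' (n := n)) :=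
  measurable_pi_lambda _ fun i => (measurable_pi_apply i).add (measurable_gradShift hm hm' i)

/-- The privacy loss of a run with noise `ξ`: the log-likelihood ratio of the descents with gradients
`m` and `m'` at the weights that `m` visits. -/
def privacyLoss (p : Seminorm ℝ (Param d)) (b : ℝ) (θ₁ : Param d) (η : ℕ → ℝ)
    (m m' : Param d → Param d) {n : ℕ} (ξ : Fin n → Param d) : ℝ :=
  ∑ i : Fin n, lossIncrement p b (gradShift θ₁ η m m' ξ i) (ξ i)

variable {p : Seminorm ℝ (Param d)} {b : ℝ}

theorem privacyLoss_snoc (ξ : Fin n → Param d) (x : Param d) :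
    privacyLoss p b θ₁ η m m' (Fin.snoc ξ x : Fin (n + 1) → Param d) =
      privacyLoss p b θ₁ η m m' ξ + lossIncrement p b (gradShift θ₁ η m m' ξ n) x := by
  simp [privacyLoss, Fin.sum_univ_castSucc, gradShift_snoc, Fin.is_le']

theorem measurable_privacyLoss (hm : Measurable m) (hm' : Measurable m') :
    Measurable (privacyLoss p b θ₁ η m m' (n := n)) := by
  refine Finset.measurable_sum _ fun i _ => ?_
  exact (continuous_lossIncrement p b).measurable.comp
    ((measurable_gradShift hm hm' i).prodMk (measurable_pi_apply i))

theorem measurable_finSnoc {E : Type*} [MeasurableSpace E] (n : ℕ) :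
    Measurable fun q : E × (Fin n → E) => (Fin.snoc q.2 q.1 : Fin (n + 1) → E) := by
  refine measurable_pi_lambda _ fun i => ?_
  refine Fin.lastCases ?_ (fun i => ?_) i
  · simpa using measurable_fst
  · simpa using (by fun_prop : Measurable fun q : E × (Fin n → E) => q.2 i)

theorem lintegral_pi_finSnoc {E : Type*} [MeasurableSpace E] (μ : Measure E) [SigmaFinite μ]
    {F : (Fin (n + 1) → E) → ENNReal} (hF : Measurable F) :
    ∫⁻ ξ, F ξ ∂(Measure.pi fun _ => μ) =
      ∫⁻ ξ, ∫⁻ x, F (Fin.snoc ξ x) ∂μ ∂(Measure.pi fun _ : Fin n => μ) := by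
  have h := (measurePreserving_piFinSuccAbove (fun _ : Fin (n + 1) => μ) (Fin.last n)).symm
  rw [← h.lintegral_comp hF]
  simp only [MeasurableEquiv.piFinSuccAbove_symm_apply, Fin.insertNthEquiv, Equiv.coe_fn_mk,
    Fin.insertNth_last']
  rw [lintegral_prod_symm']
  exact hF.comp (measurable_finSnoc n)

/-- Change of measure: weighted with `exp (-privacyLoss)`, the shifted noise is again i.i.d. Laplace
noise. The noise is shifted by amounts that depend on earlier noise only, so that the coordinates
can be treated one after the other, the last one first. -/
theorem lintegral_exp_neg_privacyLoss_mul [SigmaFinite (laplace p 0 b)] (hm : Measurable m)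
    (hm' : Measurable m') {F : (Fin n → Param d) → ENNReal} (hF : Measurable F) :
    ∫⁻ ξ, ENNReal.ofReal (Real.exp (-privacyLoss p b θ₁ η m m' ξ)) *
        F (shiftNoise θ₁ η m m' ξ) ∂(Measure.pi fun _ => laplace p 0 b) =
      ∫⁻ ξ, F ξ ∂(Measure.pi fun _ => laplace p 0 b) := by
  induction n with
  | zero =>
    refine lintegral_congr fun ξ => ?_
    rw [Subsingleton.elim (shiftNoise θ₁ η m m' ξ) ξ]
    simp [privacyLoss]
  | succ n ih =>
    have hG : Measurable fun ξ : Fin n → Param d =>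
        ∫⁻ x, F (Fin.snoc ξ x) ∂(laplace p 0 b) :=
      (hF.comp (measurable_finSnoc n)).lintegral_prod_left'
    rw [lintegral_pi_finSnoc _ hF, ← ih hG, lintegral_pi_finSnoc]
    · refine lintegral_congr fun ξ => ?_
      simp only [privacyLoss_snoc, shiftNoise_snoc, neg_add, Real.exp_add,
        ENNReal.ofReal_mul (Real.exp_pos _).le, mul_assoc]
      rw [lintegral_const_mul' _ _ ENNReal.ofReal_ne_top]
      congr 1
      exact lintegral_exp_neg_lossIncrement_mul p b (gradShift θ₁ η m m' ξ n)
        (hF.comp ((measurable_finSnoc n).comp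
          (measurable_prodMk_right (y := shiftNoise θ₁ η m m' ξ))))
    · exact ((measurable_privacyLoss hm hm').neg.exp.ennreal_ofReal).mul
        (hF.comp (measurable_shiftNoise hm hm'))

theorem measurable_sum_cumulantBound (p : Seminorm ℝ (Param d)) (hm : Measurable m)
    (hm' : Measurable m') (c : ℝ) : Measurable fun ξ : Fin n → Param d =>
      ∑ i : Fin n, cumulantBound c (p (gradShift θ₁ η m m' ξ i) / b) := by
  refine Finset.measurable_sum _ fun i _ => ?_
  have h1 := p.continuous_of_finiteDimensional.measurable.comp
    (measurable_gradShift (θ₁ := θ₁) (η := η) (n := n) hm hm' i)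
  have h2 : Measurable (cumulantBound c) := by
    unfold cumulantBound
    fun_prop
  exact h2.comp (h1.div_const b)

/-- The exponential supermartingale of the privacy loss has expectation at most `1`. -/
theorem lintegral_exp_mul_privacyLoss_sub_le_one [IsProbabilityMeasure (laplace p 0 b)]
    (hb : 0 < b) (hm : Measurable m) (hm' : Measurable m') {c : ℝ} (hc : 0 ≤ c) :
    ∫⁻ ξ : Fin n → Param d, ENNReal.ofReal (Real.exp (c * privacyLoss p b θ₁ η m m' ξ -
        ∑ i : Fin n, cumulantBound c (p (gradShift θ₁ η m m' ξ i) / b)))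
      ∂(Measure.pi fun _ => laplace p 0 b) ≤ 1 := by
  induction n with
  | zero => simp [privacyLoss]
  | succ n ih =>
    rw [lintegral_pi_finSnoc]
    · refine (lintegral_mono fun ξ => ?_).trans ih
      have hinc : Measurable (lossIncrement p b (gradShift θ₁ η m m' ξ n)) :=
        (continuous_lossIncrement p b).measurable.comp measurable_prodMk_left
      have hone := lintegral_exp_neg_lossIncrement_mul p b (gradShift θ₁ η m m' ξ n)
        (F := fun _ => 1) measurable_const
      simp only [mul_one, lintegral_one, measure_univ] at hone
      have hstep := lintegral_exp_mul_sub_cumulantBound_le_one hinc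
        (fun x => abs_lossIncrement_le p hb _ x) hone hc
      simp only [privacyLoss_snoc, Fin.sum_univ_castSucc, Fin.val_castSucc, Fin.val_last]
      have hsplit : ∀ x, ENNReal.ofReal (Real.exp (c * (privacyLoss p b θ₁ η m m' ξ +
          lossIncrement p b (gradShift θ₁ η m m' ξ n) x) -
          (∑ i : Fin n, cumulantBound c (p (gradShift θ₁ η m m'
            (Fin.snoc ξ x : Fin (n + 1) → Param d) i) / b) +
          cumulantBound c (p (gradShift θ₁ η m m'
            (Fin.snoc ξ x : Fin (n + 1) → Param d) n) / b)))) =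
          ENNReal.ofReal (Real.exp (c * privacyLoss p b θ₁ η m m' ξ -
            ∑ i : Fin n, cumulantBound c (p (gradShift θ₁ η m m' ξ i) / b))) *
          ENNReal.ofReal (Real.exp (c * lossIncrement p b (gradShift θ₁ η m m' ξ n) x -
            cumulantBound c (p (gradShift θ₁ η m m' ξ n) / b))) := fun x => by
        rw [← ENNReal.ofReal_mul (Real.exp_pos _).le, ← Real.exp_add]
        simp only [gradShift_snoc, Fin.is_le', le_refl]
        congr 2
        rw [mul_add]
        abel
      simp only [hsplit]
      rw [lintegral_const_mul' _ _ ENNReal.ofReal_ne_top]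
      exact mul_le_of_le_one_right' hstep
    · exact ((((measurable_privacyLoss hm hm').const_mul c).sub
        (measurable_sum_cumulantBound p hm hm' c)).exp).ennreal_ofReal

/-- Azuma–Hoeffding tail bound for the privacy loss of descents whose sensitivities `Δ_i` satisfy
`∑ Δ_i² ≤ V` and have total mean bound `∑ Δ_i² exp Δ_i ≤ K`. -/
theorem measure_privacyLoss_gt_le [IsProbabilityMeasure (laplace p 0 b)]
    (hb : 0 < b) (hm : Measurable m) (hm' : Measurable m') {V K δ : ℝ} (hK : 0 ≤ K) (hδ : 0 < δ)
    (hδ1 : δ ≤ 1)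
    (hV : ∀ᵐ ξ ∂(Measure.pi fun _ : Fin n => laplace p 0 b),
      ∑ i : Fin n, (p (gradShift θ₁ η m m' ξ i) / b) ^ 2 ≤ V)
    (hKs : ∀ᵐ ξ ∂(Measure.pi fun _ : Fin n => laplace p 0 b),
      ∑ i : Fin n, (p (gradShift θ₁ η m m' ξ i) / b) ^ 2 *
        Real.exp (p (gradShift θ₁ η m m' ξ i) / b) ≤ K) :
    (Measure.pi fun _ : Fin n => laplace p 0 b)
      {ξ | Real.sqrt (V * (2 * Real.log δ⁻¹)) + K < privacyLoss p b θ₁ η m m' ξ} ≤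
        ENNReal.ofReal δ := by
  set μ := Measure.pi fun _ : Fin n => laplace p 0 b
  set ℓ := Real.log δ⁻¹ with hℓ
  have hℓ0 : 0 ≤ ℓ := Real.log_nonneg ((one_le_inv₀ hδ).2 hδ1)
  have hV0 : 0 ≤ V := by
    obtain ⟨ξ, hξ⟩ := hV.exists
    exact (Finset.sum_nonneg fun i _ => sq_nonneg _).trans hξ
  rcases hV0.eq_or_lt with hV0 | hV0
  · -- all sensitivities vanish, and so does the privacy loss
    refine le_of_eq_of_le (measure_mono_null ?_ hV) zero_le
    intro ξ hξ (hle : ∑ i : Fin n, (p (gradShift θ₁ η m m' ξ i) / b) ^ 2 ≤ V)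
    rw [← hV0] at hle
    have hz := (Finset.sum_eq_zero_iff_of_nonneg fun i _ => sq_nonneg _).1
      (le_antisymm hle (Finset.sum_nonneg fun i _ => sq_nonneg _))
    have hL : privacyLoss p b θ₁ η m m' ξ = 0 := by
      refine Finset.sum_eq_zero fun i hi => abs_eq_zero.1 (le_antisymm ?_ (abs_nonneg _))
      exact (abs_lossIncrement_le p hb _ _).trans_eq (pow_eq_zero_iff two_ne_zero |>.1 (hz i hi))
    have hξ' : Real.sqrt (V * (2 * ℓ)) + K < privacyLoss p b θ₁ η m m' ξ := hξ
    rw [hL] at hξ'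
    linarith [Real.sqrt_nonneg (V * (2 * ℓ))]
  -- the exponent that is optimal in the Chernoff bound
  set c := Real.sqrt (2 * ℓ / V) with hc
  have hc0 : 0 ≤ c := Real.sqrt_nonneg _
  have hcV : c ^ 2 * V = 2 * ℓ := by
    rw [hc, Real.sq_sqrt (by positivity)]
    field_simp
  have hcs : c * Real.sqrt (V * (2 * ℓ)) = 2 * ℓ := by
    rw [hc, ← Real.sqrt_mul (by positivity)]
    have : 2 * ℓ / V * (V * (2 * ℓ)) = (2 * ℓ) ^ 2 := by field_simp
    rw [this, Real.sqrt_sq (by positivity)]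
  set f : (Fin n → Param d) → ENNReal := fun ξ =>
    ENNReal.ofReal (Real.exp (c * privacyLoss p b θ₁ η m m' ξ -
        ∑ i : Fin n, cumulantBound c (p (gradShift θ₁ η m m' ξ i) / b))) with hf
  have hfm : Measurable f := ((((measurable_privacyLoss hm hm').const_mul c).sub
        (measurable_sum_cumulantBound p hm hm' c)).exp).ennreal_ofReal
  have hmarkov := mul_meas_ge_le_lintegral (μ := μ) hfm (ENNReal.ofReal δ⁻¹)
  have hint : ∫⁻ ξ, f ξ ∂μ ≤ 1 := lintegral_exp_mul_privacyLoss_sub_le_one hb hm hm' hc0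
  have hsub : μ {ξ | Real.sqrt (V * (2 * ℓ)) + K < privacyLoss p b θ₁ η m m' ξ} ≤
      μ {ξ | ENNReal.ofReal δ⁻¹ ≤ f ξ} := by
    refine measure_mono_ae ?_
    filter_upwards [hV, hKs] with ξ h1 h2 h3
    refine ENNReal.ofReal_le_ofReal ?_
    rw [← Real.exp_log (inv_pos.2 hδ), ← hℓ]
    refine Real.exp_le_exp.2 ?_
    have h3' : Real.sqrt (V * (2 * ℓ)) + K < privacyLoss p b θ₁ η m m' ξ := h3
    have h4 := mul_le_mul_of_nonneg_left h3'.le hc0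
    rw [mul_add, hcs] at h4
    simp only [cumulantBound, Finset.sum_add_distrib, ← Finset.mul_sum, ← Finset.sum_div]
    have h5 := mul_le_mul_of_nonneg_left h1 (sq_nonneg c)
    have h6 := mul_le_mul_of_nonneg_left h2 hc0
    linarith
  have hδ' : ENNReal.ofReal δ * ENNReal.ofReal δ⁻¹ = 1 := by
    rw [← ENNReal.ofReal_mul hδ.le, mul_inv_cancel₀ hδ.ne', ENNReal.ofReal_one]
  calc _ ≤ μ {ξ | ENNReal.ofReal δ⁻¹ ≤ f ξ} := hsub
    _ = ENNReal.ofReal δ * (ENNReal.ofReal δ⁻¹ * μ {ξ | ENNReal.ofReal δ⁻¹ ≤ f ξ}) := by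
        rw [← mul_assoc, hδ', one_mul]
    _ ≤ ENNReal.ofReal δ * 1 := by
        gcongr
        exact hmarkov.trans hint
    _ = _ := mul_one _

/-- Two noisy gradient descents have `(ε, δ)`-close outputs if the privacy loss exceeds `ε` with
probability at most `δ`. -/
theorem measure_noisySGD_le [IsProbabilityMeasure (laplace p 0 b)] (hm : Measurable m)
    (hm' : Measurable m') {ε δ : ℝ}
    (htail : (Measure.pi fun _ : Fin n => laplace p 0 b)
      {ξ | ε < privacyLoss p b θ₁ η m m' ξ} ≤ ENNReal.ofReal δ)
    {B : Set (Param d)} (hB : MeasurableSet B) :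
    (Measure.pi fun _ : Fin n => laplace p 0 b) {ξ | noisySGD θ₁ η m ξ n ∈ B} ≤
      ENNReal.ofReal (Real.exp ε) *
        (Measure.pi fun _ : Fin n => laplace p 0 b) {ξ | noisySGD θ₁ η m' ξ n ∈ B} +
      ENNReal.ofReal δ := by
  set μ := Measure.pi fun _ : Fin n => laplace p 0 b
  have hE : MeasurableSet {ξ : Fin n → Param d | noisySGD θ₁ η m ξ n ∈ B} :=
    measurable_noisySGD hm n hB
  have hE' : MeasurableSet {ξ : Fin n → Param d | noisySGD θ₁ η m' ξ n ∈ B} :=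
    measurable_noisySGD hm' n hB
  have hL : MeasurableSet {ξ : Fin n → Param d | ε < privacyLoss p b θ₁ η m m' ξ} :=
    measurableSet_lt measurable_const (measurable_privacyLoss hm hm')
  rw [← measure_inter_add_sdiff _ hL, add_comm]
  refine add_le_add ?_ ((measure_mono Set.inter_subset_right).trans htail)
  have hcov := lintegral_exp_neg_privacyLoss_mul (p := p) (b := b) (θ₁ := θ₁) (η := η) hm hm'
    (measurable_one.indicator hE')
  rw [lintegral_indicator_one hE'] at hcov
  rw [← hcov, ← lintegral_const_mul' _ _ ENNReal.ofReal_ne_top,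
    ← lintegral_indicator_one (hE.diff hL)]
  refine lintegral_mono fun ξ => ?_
  refine Set.indicator_apply_le' (fun hξ => ?_) (fun _ => zero_le)
  have hmem : shiftNoise θ₁ η m m' ξ ∈ {ξ : Fin n → Param d | noisySGD θ₁ η m' ξ n ∈ B} := by
    change noisySGD θ₁ η m' (shiftNoise θ₁ η m m' ξ) n ∈ B
    rw [noisySGD_shiftNoise ξ le_rfl]
    exact hξ.1
  rw [Set.indicator_of_mem hmem, Pi.one_apply, Pi.one_apply, mul_one,
    ← ENNReal.ofReal_mul (Real.exp_pos _).le, ← Real.exp_add, ENNReal.one_le_ofReal]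
  have : privacyLoss p b θ₁ η m m' ξ ≤ ε := not_lt.1 hξ.2
  exact Real.one_le_exp (by linarith)

end Adaptive

/-! ### Sensitivity of the adversarial risk -/

/-- The gradient, set to `0` where `f` is not differentiable, is measurable for every `f` whatsoever.
No regularity of the robust loss is therefore needed to make the weights measurable in the noise. -/
theorem measurable_gradient {E : Type*} [NormedAddCommGroup E] [InnerProductSpace ℝ E]
    [CompleteSpace E] [MeasurableSpace E] [BorelSpace E] (f : E → ℝ) : Measurable (gradient f) :=
  (InnerProductSpace.toDual ℝ E).symm.continuous.measurable.comp (measurable_fderiv ℝ f)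

namespace AdvProblem

variable {d : ℕ} {X Y W : Type*} [NormedAddCommGroup X] [NormedSpace ℝ X]
  (P : AdvProblem d X Y W) {N : ℕ}

theorem gradient_advRisk {S : Fin N → P.examples} {θ : Param d}
    (h : ∀ i, DifferentiableAt ℝ (P.robustLoss (S i)) θ) :
    gradient (P.advRisk S) θ = (1 / (N : ℝ)) • ∑ i, gradient (P.robustLoss (S i)) θ := by
  refine HasGradientAt.gradient ?_
  rw [hasGradientAt_iff_hasFDerivAt]
  have h1 : HasFDerivAt (fun θ => ∑ i, P.robustLoss (S i) θ)
      (∑ i, fderiv ℝ (P.robustLoss (S i)) θ) θ :=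
    HasFDerivAt.fun_sum fun i _ => (h i).hasFDerivAt
  convert! h1.const_mul (1 / (N : ℝ)) using 1
  simp [gradient]

theorem paramNorm_gradient_advRisk_sub_le {S S' : Fin N → P.examples}
    (hS : ∃ i, ∀ j, j ≠ i → S j = S' j) {θ : Param d} {G : ℝ}
    (hd : ∀ i, DifferentiableAt ℝ (P.robustLoss (S i)) θ)
    (hd' : ∀ i, DifferentiableAt ℝ (P.robustLoss (S' i)) θ)
    (hG : ∀ z ∈ P.examples, P.paramNorm (gradient (P.robustLoss z) θ) ≤ G) :
    P.paramNorm (gradient (P.advRisk S) θ - gradient (P.advRisk S') θ) ≤ 2 * G / N := by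
  obtain ⟨i, hi⟩ := hS
  rw [P.gradient_advRisk hd, P.gradient_advRisk hd', ← smul_sub, ← Finset.sum_sub_distrib,
    Finset.sum_eq_single_of_mem i (Finset.mem_univ i) fun j _ hj => by rw [hi j hj, sub_self],
    map_smul_eq_mul, Real.norm_of_nonneg (by positivity), one_div, inv_mul_eq_div]
  gcongr
  have h1 := map_sub_le_add P.paramNorm (gradient (P.robustLoss (S i)) θ)
    (gradient (P.robustLoss (S' i)) θ)
  linarith [hG _ (S i).2, hG _ (S' i).2]

theorem paramNorm_gradient_le_gradMaxAdv {θ : Param d} {M : ℝ}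
    (hM : ∀ z ∈ P.examples, P.paramNorm (gradient (P.robustLoss z) θ) ≤ M) {z : X × Y}
    (hz : z ∈ P.examples) : P.paramNorm (gradient (P.robustLoss z) θ) ≤ P.gradMaxAdv θ :=
  le_csSup ⟨M, by rintro _ ⟨w, hw, rfl⟩; exact hM w hw⟩ ⟨z, hz, rfl⟩

/-- Almost surely, the two risk gradients at the weights visited on `S` differ by at most `2/N` times
any bound for the gradients of the robust losses. Differentiability along the run on `S` is needed
for the examples in `S'` too, hence `hdiff` for all examples. -/
theorem ae_gradShift_advRisk_le {b : ℝ} {T : ℕ} {η : ℕ → ℝ} {θ₁ : Param d}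
    {S S' : Fin N → P.examples} (hS : ∃ i, ∀ j, j ≠ i → S j = S' j)
    (hdiff : ∀ z ∈ P.examples, ∀ᵐ ξ ∂(P.noiseLaw b T), ∀ t < T,
      DifferentiableAt ℝ (P.robustLoss z) (P.advIterate η θ₁ S ξ t)) :
    ∀ᵐ ξ ∂(P.noiseLaw b T), ∀ t < T, ∀ G : ℝ,
      (∀ z ∈ P.examples,
        P.paramNorm (gradient (P.robustLoss z) (P.advIterate η θ₁ S ξ t)) ≤ G) →
      P.paramNorm (gradShift θ₁ η (gradient (P.advRisk S)) (gradient (P.advRisk S')) ξ t) ≤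
        2 * G / N := by
  have h1 : ∀ᵐ ξ ∂(P.noiseLaw b T), ∀ i, ∀ t < T,
      DifferentiableAt ℝ (P.robustLoss (S i)) (P.advIterate η θ₁ S ξ t) :=
    ae_all_iff.2 fun i => hdiff _ (S i).2
  have h2 : ∀ᵐ ξ ∂(P.noiseLaw b T), ∀ i, ∀ t < T,
      DifferentiableAt ℝ (P.robustLoss (S' i)) (P.advIterate η θ₁ S ξ t) :=
    ae_all_iff.2 fun i => hdiff _ (S' i).2
  filter_upwards [h1, h2] with ξ h1 h2 t ht G hG
  exact P.paramNorm_gradient_advRisk_sub_le hS (fun i => h1 i t ht) (fun i => h2 i t ht) hG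

end AdvProblem

/-! ### The fourth-power means -/

theorem fourthMean_nonneg (T : ℕ) (a : ℕ → ℝ) : 0 ≤ fourthMean T a :=
  Real.rpow_nonneg (mul_nonneg (by positivity)
    (Finset.sum_nonneg fun t _ => (by decide : Even 4).pow_nonneg (a t))) _

theorem mul_fourthMean_pow_four (T : ℕ) (a : ℕ → ℝ) :
    T * fourthMean T a ^ 4 = ∑ t ∈ Finset.range T, a t ^ 4 := by
  rcases T.eq_zero_or_pos with rfl | hT
  · simp
  have h0 : 0 ≤ (1 / (T : ℝ)) * ∑ t ∈ Finset.range T, a t ^ 4 :=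
    mul_nonneg (by positivity) (Finset.sum_nonneg fun t _ => (by decide : Even 4).pow_nonneg (a t))
  have hT' : (T : ℝ) ≠ 0 := by positivity
  rw [fourthMean, ← Real.rpow_natCast, ← Real.rpow_mul h0]
  norm_num
  field_simp

theorem sum_sq_mul_le_fourthMean (T : ℕ) (a c : ℕ → ℝ) :
    ∑ t ∈ Finset.range T, (a t * c t) ^ 2 ≤ T * (fourthMean T a * fourthMean T c) ^ 2 := by
  refine le_of_sq_le_sq ?_ (by positivity)
  have h := Finset.sum_mul_sq_le_sq_mul_sq (Finset.range T) (fun t => a t ^ 2) (fun t => c t ^ 2)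
  have ha := mul_fourthMean_pow_four T a
  have hc := mul_fourthMean_pow_four T c
  simp only [← pow_mul, ← mul_pow] at h
  norm_num at h
  rw [← ha, ← hc] at h
  calc _ ≤ _ := h
    _ = _ := by ring

theorem AdvProblem.privacyScale_nonneg {d : ℕ} {X Y W : Type*} [NormedAddCommGroup X]
    [NormedSpace ℝ X] (P : AdvProblem d X Y W) {b : ℝ} (hb : 0 < b) (N T : ℕ)
    (θA θE : ℕ → Param d) : 0 ≤ P.privacyScale b N T θA θE :=
  mul_nonneg (div_nonneg (mul_nonneg zero_le_two (fourthMean_nonneg _ _)) (by positivity))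
    (fourthMean_nonneg _ _)

/-- The squared sensitivities of `T` steps sum up to at most `T ε_{1:T}²`: write `L^A_t` as the
product of `L^ERM_t` and the intensity and apply the Cauchy–Schwarz inequality. -/
theorem AdvProblem.sum_sq_sensitivity_le {d : ℕ} {X Y W : Type*} [NormedAddCommGroup X]
    [NormedSpace ℝ X] (P : AdvProblem d X Y W) (b : ℝ) (N T : ℕ)
    {θA θE : ℕ → Param d} (hE : ∀ t < T, 0 < P.gradMaxERM (θE t)) :
    ∑ t ∈ Finset.range T, (2 * P.gradMaxAdv (θA t) / N / b) ^ 2 ≤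
      T * P.privacyScale b N T θA θE ^ 2 := by
  have h := sum_sq_mul_le_fourthMean T (fun t => P.gradMaxERM (θE t))
    (fun t => P.intensity (θA t) (θE t))
  calc ∑ t ∈ Finset.range T, (2 * P.gradMaxAdv (θA t) / N / b) ^ 2
      = (2 / (N * b)) ^ 2 * ∑ t ∈ Finset.range T,
          (P.gradMaxERM (θE t) * P.intensity (θA t) (θE t)) ^ 2 := by
        rw [Finset.mul_sum]
        refine Finset.sum_congr rfl fun t ht => ?_
        rw [intensity, mul_div_cancel₀ _ (hE t (Finset.mem_range.1 ht)).ne', ← mul_pow]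
        congr 1
        rw [div_div, div_mul_eq_mul_div]
    _ ≤ (2 / (N * b)) ^ 2 * (T * (fourthMean T (fun t => P.gradMaxERM (θE t)) *
          fourthMean T (fun t => P.intensity (θA t) (θE t))) ^ 2) := by gcongr
    _ = T * P.privacyScale b N T θA θE ^ 2 := by
        rw [privacyScale, totalERM, totalIntensity]
        ring

/-! ### Differential privacy of adversarial training -/

theorem mainTheorem2 {d : ℕ} {X Y W : Type*} [NormedAddCommGroup X] [NormedSpace ℝ X]
    (P : AdvProblem d X Y W) (b : ℝ) (hb : 0 < b) (T : ℕ) (η : ℕ → ℝ) (θA₁ θE₁ : Param d)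
    -- almost surely, the robust loss of each example is differentiable at the visited weights
    (hdiff : ∀ N : ℕ, 0 < N → ∀ (S : Fin N → P.examples), ∀ z ∈ P.examples,
      ∀ᵐ ξ ∂(P.noiseLaw b T), ∀ t < T,
        DifferentiableAt ℝ (P.robustLoss z) (P.advIterate η θA₁ S ξ t))
    -- almost surely, its gradients at the visited weights are bounded
    (M : ℝ)
    (hM : ∀ N : ℕ, 0 < N → ∀ (S : Fin N → P.examples),
      ∀ᵐ ξ ∂(P.noiseLaw b T), ∀ t < T, ∀ z ∈ P.examples,
        P.paramNorm (gradient (P.robustLoss z) (P.advIterate η θA₁ S ξ t)) ≤ M) :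
    ∃ C : ℝ, ∀ N : ℕ, 0 < N → ∀ δ' : ℝ, 0 < δ' →
      -- the mini batches used by ERM on each sample set
      ∀ B : (Fin N → P.examples) → ℕ → Finset (Fin N),
      (∀ S : Fin N → P.examples, ∀ t < T,
        0 < P.gradMaxERM (P.ermIterate η θE₁ S (B S) t)) →
      ∀ ε₁T : ℝ,
      (∀ S : Fin N → P.examples, ∀ᵐ ξ ∂(P.noiseLaw b T),
        P.privacyScale b N T (P.advIterate η θA₁ S ξ) (P.ermIterate η θE₁ S (B S)) ≤ ε₁T) →
      IsDifferentiallyPrivate (P.advTraining b T η θA₁ (N := N))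
        (ε₁T * Real.sqrt (2 * T * Real.log (N / δ')) + C / (N : ℝ) ^ 2) (δ' / N) := by
  -- `D / N` bounds the sensitivity of each step
  set D : ℝ := 2 * max M 0 / b with hD
  have hD0 : 0 ≤ D := by positivity
  -- the steps' mean privacy losses sum up to at most `T (D / N)² exp (D / N) ≤ T D² exp D / N²`
  refine ⟨T * (D ^ 2 * Real.exp D), fun N hN δ' hδ' B hB ε₁T hε S S' hSS' A hA => ?_⟩
  have hprob := isProbabilityMeasure_laplace (p := P.paramNorm) P.eq_zero_of_paramNorm hb 0
  have hN' : (0 : ℝ) < N := Nat.cast_pos.2 hN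
  have hm (S : Fin N → P.examples) := measurable_gradient (P.advRisk S)
  have hout (S : Fin N → P.examples) : Measurable fun ξ : Fin T → Param d =>
      P.advIterate η θA₁ S ξ T := measurable_noisySGD (hm S) T
  have hprobN : IsProbabilityMeasure (P.noiseLaw b T) := by
    unfold AdvProblem.noiseLaw
    infer_instance
  have hprobA (S : Fin N → P.examples) : IsProbabilityMeasure (P.advTraining b T η θA₁ S) :=
    Measure.isProbabilityMeasure_map (hout S).aemeasurable
  -- for `δ' ≥ N` the additive term alone is at least `1`
  rcases le_or_gt 1 (δ' / N) with hδ1 | hδ1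
  · have h1 : (P.advTraining b T η θA₁ S).real A ≤ 1 := measureReal_le_one
    have h2 : 0 ≤ Real.exp (ε₁T * Real.sqrt (2 * T * Real.log (N / δ')) +
        T * (D ^ 2 * Real.exp D) / (N : ℝ) ^ 2) * (P.advTraining b T η θA₁ S').real A := by
      positivity
    linarith
  have hδ0 : 0 < δ' / N := by positivity
  have hε0 : 0 ≤ ε₁T := by
    obtain ⟨ξ, hξ⟩ := (hε S).exists
    exact (P.privacyScale_nonneg hb N T _ _).trans hξ
  have hsens := P.ae_gradShift_advRisk_le hSS' (hdiff N hN S)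
  have hV : ∀ᵐ ξ ∂(P.noiseLaw b T), ∑ i : Fin T, (P.paramNorm (gradShift θA₁ η
      (gradient (P.advRisk S)) (gradient (P.advRisk S')) ξ i) / b) ^ 2 ≤ T * ε₁T ^ 2 := by
    filter_upwards [hsens, hM N hN S, hε S] with ξ h1 h2 h3
    rw [← Finset.sum_range (f := fun t => (P.paramNorm (gradShift θA₁ η
      (gradient (P.advRisk S)) (gradient (P.advRisk S')) ξ t) / b) ^ 2)]
    calc _ ≤ ∑ t ∈ Finset.range T, (2 * P.gradMaxAdv (P.advIterate η θA₁ S ξ t) / N / b) ^ 2 := by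
          refine Finset.sum_le_sum fun t ht => ?_
          have ht' := Finset.mem_range.1 ht
          gcongr
          exact h1 t ht' _ fun z hz => P.paramNorm_gradient_le_gradMaxAdv (h2 t ht') hz
      _ ≤ T * P.privacyScale b N T (P.advIterate η θA₁ S ξ) (P.ermIterate η θE₁ S (B S)) ^ 2 :=
          P.sum_sq_sensitivity_le b N T (hB S)
      _ ≤ T * ε₁T ^ 2 := by
          have := P.privacyScale_nonneg hb N T (P.advIterate η θA₁ S ξ)
            (P.ermIterate η θE₁ S (B S))
          gcongr
  have hK : ∀ᵐ ξ ∂(P.noiseLaw b T), ∑ i : Fin T, (P.paramNorm (gradShift θA₁ η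
      (gradient (P.advRisk S)) (gradient (P.advRisk S')) ξ i) / b) ^ 2 *
      Real.exp (P.paramNorm (gradShift θA₁ η (gradient (P.advRisk S))
        (gradient (P.advRisk S')) ξ i) / b) ≤ T * (D ^ 2 * Real.exp D) / (N : ℝ) ^ 2 := by
    filter_upwards [hsens, hM N hN S] with ξ h1 h2
    have hle : ∀ i : Fin T, P.paramNorm (gradShift θA₁ η
        (gradient (P.advRisk S)) (gradient (P.advRisk S')) ξ i) / b ≤ D / N := fun i => by
      have := h1 i i.2 (max M 0) fun z hz => (h2 i i.2 z hz).trans (le_max_left _ _)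
      rw [hD, div_right_comm]
      gcongr
    have hDN : D / N ≤ D := div_le_self hD0 (Nat.one_le_cast.2 hN)
    calc _ ≤ ∑ _i : Fin T, (D / N) ^ 2 * Real.exp D := by
          refine Finset.sum_le_sum fun i _ => mul_le_mul
            (pow_le_pow_left₀ (by positivity) (hle i) 2)
            (Real.exp_le_exp.2 ((hle i).trans hDN)) (Real.exp_pos _).le (by positivity)
      _ = T * (D ^ 2 * Real.exp D) / (N : ℝ) ^ 2 := by
          rw [Finset.sum_const, Finset.card_univ, Fintype.card_fin, nsmul_eq_mul]
          ring
  have htail := measure_privacyLoss_gt_le hb (hm S) (hm S') (by positivity) hδ0 hδ1.le hV hK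
  have hsqrt : Real.sqrt (T * ε₁T ^ 2 * (2 * Real.log (δ' / N)⁻¹)) =
      ε₁T * Real.sqrt (2 * T * Real.log (N / δ')) := by
    rw [inv_div, ← Real.sqrt_sq hε0, ← Real.sqrt_mul (sq_nonneg _), Real.sqrt_sq hε0]
    ring_nf
  rw [hsqrt] at htail
  have hfin := measure_noisySGD_le (hm S) (hm S') htail hA
  rw [AdvProblem.advTraining, AdvProblem.advTraining, map_measureReal_apply (hout S) hA,
    map_measureReal_apply (hout S') hA, measureReal_def, measureReal_def]
  have hreal := ENNReal.toReal_mono (by finiteness) hfin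
  rw [ENNReal.toReal_add (by finiteness) (by finiteness), ENNReal.toReal_mul,
    ENNReal.toReal_ofReal (Real.exp_pos _).le, ENNReal.toReal_ofReal hδ0.le] at hreal
  exact hreal

end
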